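/- Let $0<\alpha<1$, $0<\theta<1$, $0<\Lambda<1$ and $I=[1-\theta,\,1-\Lambda\theta]\subset(0,1)$. Consider the free boundary problem $$\text{(P)}\qquad \Lambda v''-cv'=v^{\alpha}\ \text{ on } (0,R),\qquad 0<v(0)<1,\quad v'(0)=-\frac{c}{\Lambda}\,(1-v(0)),\qquad v(R)=v'(R)=0,$$ where a solution is a triple $(c,R,v)$ with $c>0$, $0<R<+\infty$, $v\in C^\infty([0,R))\cap C^1([0,R])$ and $v\ge 0$ on $[0,R]$. Then: (1) For every $v_0\in I$, problem (P) has exactly one solution with $v(0)=v_0$; denote it by $(c(v_0),R(v_0),v(v_0;\cdot))$. Hence the map $\Phi:I\to I$, $$\Phi(v_0)=P\Big(1-\theta+(1-\Lambda)\int_0^{R(v_0)}e^{-c(v_0)s}\,\big(-v'(v_0;s)\big)\,ds\Big),$$ is well defined, where $P:\mathbb R\to I$ is the projection $P(x)=\min\{\max\{x,1-\theta\},1-\Lambda\theta\}$. (2) $\Phi$ has a fixed point in $I$. (3) For every fixed point $v_0^*$ of $\Phi$, the triple $(c,R,v)=(c(v_0^*),R(v_0^*),v(v_0^*;\cdot))$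 is a solution of (P) with $v(0)=v_0^*$ that satisfies in addition the integral equation $$\theta+v(0)=1-(1-\Lambda)\int_0^{R}e^{-cs}v'(s)\,ds .$$ Moreover the projection is not active at $v_0^*$: the argument of $P$ in the definition of $\Phi(v_0^*)$ lies in the open interval $(1-\theta,\,1-\Lambda\theta)$. -/

import Mathlib

open Set

namespace FlameFront

/-- The one-phase free boundary problem for the concentration `v` on `[0, R]`, with reaction order
`α` and inverse Lewis number `Λ`; the unknowns are the speed `c`, the free boundary `R` and `v`.
Only the values of `v` on `[0, R]` matter. Non-negativity of `v` is what gives the real power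
`v ^ α` its meaning. Derivatives at the two end points are one-sided. -/
structure IsFreeBoundarySolution (α Λ c R : ℝ) (v : ℝ → ℝ) : Prop where
  speed_pos : 0 < c
  boundary_pos : 0 < R
  smooth : ContDiffOn ℝ ((⊤ : ℕ∞) : WithTop ℕ∞) v (Ico 0 R)
  contDiffOn_one : ContDiffOn ℝ 1 v (Icc 0 R)
  nonneg : ∀ ξ ∈ Icc 0 R, 0 ≤ v ξ
  ode : ∀ ξ ∈ Ioo 0 R, Λ * deriv (deriv v) ξ - c * deriv v ξ = v ξ ^ α
  init_pos : 0 < v 0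
  init_lt_one : v 0 < 1
  deriv_init : derivWithin v (Icc 0 R) 0 = -(c / Λ) * (1 - v 0)
  eq_zero : v R = 0
  deriv_eq_zero : derivWithin v (Icc 0 R) R = 0

/-- The scalar problem with prescribed initial value `v 0 = v₀`. -/
structure IsScalarSolution (α Λ v₀ c R : ℝ) (v : ℝ → ℝ) : Prop extends
    IsFreeBoundarySolution α Λ c R v where
  init : v 0 = v₀

/-- The scalar problem with initial value `v₀` has one and only one solution `(c, R, v)`, where
`v` is regarded as a function on `[0, R]`. -/
def ScalarWellPosed (α Λ v₀ : ℝ) : Prop :=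
  ∃ (c R : ℝ) (v : ℝ → ℝ), IsScalarSolution α Λ v₀ c R v ∧
    ∀ (c' R' : ℝ) (v' : ℝ → ℝ), IsScalarSolution α Λ v₀ c' R' v' →
      c' = c ∧ R' = R ∧ EqOn v' v (Icc 0 R)

/-- The solution `(c(v₀), R(v₀), v(v₀; ·))` of the scalar problem with initial value `v₀`
(an arbitrary triple if there were none). -/
noncomputable def scalarSolution (α Λ v₀ : ℝ) : ℝ × ℝ × (ℝ → ℝ) :=
  Classical.epsilon fun p => IsScalarSolution α Λ v₀ p.1 p.2.1 p.2.2

/-- The speed `c(v₀)`. -/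
noncomputable def speed (α Λ v₀ : ℝ) : ℝ := (scalarSolution α Λ v₀).1

/-- The free boundary `R(v₀)`. -/
noncomputable def boundary (α Λ v₀ : ℝ) : ℝ := (scalarSolution α Λ v₀).2.1

/-- The profile `v(v₀; ·)`. -/
noncomputable def profile (α Λ v₀ : ℝ) : ℝ → ℝ := (scalarSolution α Λ v₀).2.2

/-- The derivative `v'(v₀; ·)` of the profile on `[0, R(v₀)]`. -/
noncomputable def profileDeriv (α Λ v₀ : ℝ) : ℝ → ℝ :=
  derivWithin (profile α Λ v₀) (Icc 0 (boundary α Λ v₀))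

/-- The quantity `1 - θ + (1 - Λ) ∫₀^{R(v₀)} exp (-c(v₀) s) (-v'(v₀; s)) ds`,
before projection. -/
noncomputable def prePhi (α θ Λ v₀ : ℝ) : ℝ :=
  1 - θ + (1 - Λ) * ∫ s in (0 : ℝ)..(boundary α Λ v₀),
    Real.exp (-(speed α Λ v₀) * s) * (-(profileDeriv α Λ v₀ s))

/-- The map `Φ` from the interval `[1 - θ, 1 - Λ θ]` to itself: `prePhi` followed by the projection
of the real line onto that interval. -/
noncomputable def Phi (α θ Λ : ℝ) (hI : 1 - θ ≤ 1 - Λ * θ)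
    (v₀ : Icc (1 - θ) (1 - Λ * θ)) : Icc (1 - θ) (1 - Λ * θ) :=
  projIcc (1 - θ) (1 - Λ * θ) hI (prePhi α θ Λ v₀)

theorem endpoint_le {θ Λ : ℝ} (hθ : 0 < θ) (hΛ : Λ < 1) : 1 - θ ≤ 1 - Λ * θ := by
  nlinarith

end FlameFront

/-! Look backwards from the free boundary. With `t = c (R - ξ)`, `v = lam * u` and `lam * c ^ 2 =
lam ^ α`, the problem becomes `Λ u'' + u' = u ^ α`, `u 0 = u' 0 = 0`, free of `c` and `R`. Since `α
< 1`, rest does not determine the solution: zero and delayed departures are also solutions. But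
there is exactly one solution `U` positive for all `t > 0` (`exists_isUniversalProfile`,
`IsOrbit.eqOn_of_pos`); it detaches like `t ^ (2 / (1 - α))`. Smoothness of `v` on `[0, R)` rules
out a delay, because a delayed copy of `U` is not flat where it detaches (`IsOrbit.pos_of_smooth`).

So all solutions are rescalings of `U`, labelled by the travel time `T = c R`. Writing `V = U'`, the
condition at `ξ = 0` forces `lam = 1 / (Λ V T + U T)`, hence `v 0 = U T / (Λ V T + U T)`. This ratio
increases strictly from `0` to `1` because `U` is strictly log-concave (`mul_deriv_deriv_lt`), which
gives (1).

The fixed point comes from the intermediate value theorem in the variable `T`. The integral in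
`prePhi` lies strictly between `0` and `lam * V T`; the lower bound keeps `prePhi` above `1 - θ`,
and at `v 0 = 1 - Λ θ` one has `lam * V T = θ`, so the upper bound excludes an active projection. -/

namespace FlameFront

open MeasureTheory Filter
open scoped ENNReal Topology

/-! ### Construction of the universal profile between power-law barriers. -/

/-- The solution operator of `Λ u'' + u' = f ^ α`, `u 0 = u' 0 = 0`, on `[0, ∞]`-valued
functions. -/
noncomputable def kernelOp (α Λ : ℝ) (f : ℝ → ℝ≥0∞) (t : ℝ) : ℝ≥0∞ :=
  ∫⁻ s in Ioi 0, ENNReal.ofReal (1 - Real.exp (-(t - s) / Λ)) * f s ^ α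

theorem kernelOp_mono {α Λ : ℝ} (hα : 0 ≤ α) : Monotone (kernelOp α Λ) := by
  intro f g h t
  refine lintegral_mono fun s => ?_
  have := ENNReal.rpow_le_rpow (h s) hα
  gcongr

theorem kernelOp_apply_mono {α Λ : ℝ} (hΛ : 0 < Λ) (f : ℝ → ℝ≥0∞) :
    Monotone (kernelOp α Λ f) := by
  intro t t' h
  refine lintegral_mono fun s => ?_
  dsimp only
  gcongr

theorem kernel_eq_zero {Λ t s : ℝ} (hΛ : 0 < Λ) (h : t ≤ s) :
    ENNReal.ofReal (1 - Real.exp (-(t - s) / Λ)) = 0 := by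
  apply ENNReal.ofReal_of_nonpos
  have : 0 ≤ -(t - s) / Λ := div_nonneg (by linarith) hΛ.le
  linarith [Real.one_le_exp this]

theorem kernelOp_eq_zero {α Λ : ℝ} (hΛ : 0 < Λ) (f : ℝ → ℝ≥0∞) {t : ℝ}
    (ht : t ≤ 0) : kernelOp α Λ f t = 0 := by
  unfold kernelOp
  rw [setLIntegral_congr_fun (g := fun _ => 0) measurableSet_Ioi, lintegral_zero]
  intro s hs
  have hs : 0 < s := hs
  simp only
  rw [kernel_eq_zero hΛ (by linarith), zero_mul]

/-- The exponent with which solutions detach from zero. -/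
noncomputable def detachExp (α : ℝ) : ℝ := 2 / (1 - α)

theorem detachExp_pos {α : ℝ} (hα : α < 1) : 0 < detachExp α :=
  div_pos two_pos (by linarith)

/-- The exponent `m = 2 / (1 - α)` is the solution of `α * m + 2 = m`: two integrations of `u ^ α`
restore the power. -/
theorem rpow_detachExp_mul {α t : ℝ} (hα : α < 1) (ht : 0 < t) :
    (t ^ detachExp α) ^ α * t ^ 2 = t ^ detachExp α := by
  rw [← Real.rpow_mul ht.le, ← Real.rpow_natCast, ← Real.rpow_add ht]
  congr 1
  have : (1 - α) ≠ 0 := by linarith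
  unfold detachExp
  push_cast
  field_simp
  ring

theorem rpow_inv_one_sub {α k : ℝ} (hα : α < 1) (hk : 0 < k) :
    k * (k ^ (1 / (1 - α))) ^ α = k ^ (1 / (1 - α)) := by
  have h : (1 - α) ≠ 0 := by linarith
  rw [← Real.rpow_mul hk.le]
  nth_rewrite 1 [← Real.rpow_one k]
  rw [← Real.rpow_add hk]
  congr 1
  field_simp
  ring

/-- The kernel is at most `t / Λ` and acts on an interval of length `t`, so it contributes at most
`t ^ 2 / Λ`; the coefficient `A` solves `A = A ^ α / Λ`. -/
theorem kernelOp_super {α Λ : ℝ} (hα0 : 0 < α) (hα1 : α < 1) (hΛ : 0 < Λ) :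
    kernelOp α Λ (fun t => ENNReal.ofReal ((1 / Λ) ^ (1 / (1 - α)) * t ^ detachExp α)) ≤
      fun t => ENNReal.ofReal ((1 / Λ) ^ (1 / (1 - α)) * t ^ detachExp α) := by
  intro t
  rcases le_or_gt t 0 with ht | ht
  · rw [kernelOp_eq_zero hΛ _ ht]
    exact zero_le
  set A := (1 / Λ) ^ (1 / (1 - α)) with hA
  have hA0 : 0 < A := Real.rpow_pos_of_pos (by positivity) _
  have hm := detachExp_pos hα1
  set C : ℝ := t / Λ * (A * t ^ detachExp α) ^ α with hC
  have hC0 : 0 ≤ C := by positivity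
  calc kernelOp α Λ (fun t => ENNReal.ofReal (A * t ^ detachExp α)) t
      ≤ ∫⁻ s in Ioi 0, (Ioc 0 t).indicator (fun _ => ENNReal.ofReal C) s := by
        refine setLIntegral_mono' measurableSet_Ioi fun s (hs : 0 < s) => ?_
        rcases le_or_gt t s with h | h
        · rw [kernel_eq_zero hΛ h, zero_mul]; exact zero_le
        rw [indicator_of_mem (show s ∈ Ioc 0 t from ⟨hs, h.le⟩), hC,
          ENNReal.ofReal_mul (by positivity), ENNReal.ofReal_rpow_of_nonneg (by positivity) hα0.le]
        gcongr
        have := Real.add_one_le_exp (-(t - s) / Λ)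
        have h2 : -(t - s) / Λ = s / Λ - t / Λ := by ring
        have : 0 < s / Λ := by positivity
        linarith
    _ ≤ ∫⁻ s, (Ioc 0 t).indicator (fun _ => ENNReal.ofReal C) s := setLIntegral_le_lintegral _ _
    _ = ENNReal.ofReal (C * t) := by
        rw [lintegral_indicator measurableSet_Ioc, setLIntegral_const, Real.volume_Ioc,
          ENNReal.ofReal_mul hC0, sub_zero]
    _ = ENNReal.ofReal (A * t ^ detachExp α) := by
        congr 1
        rw [hC, Real.mul_rpow hA0.le (by positivity)]
        calc t / Λ * (A ^ α * (t ^ detachExp α) ^ α) * t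
            = (1 / Λ * A ^ α) * ((t ^ detachExp α) ^ α * t ^ 2) := by ring
          _ = _ := by rw [rpow_detachExp_mul hα1 ht, rpow_inv_one_sub hα1 (by positivity)]

/-- The coefficient of a subsolution on `[0, T]`. -/
noncomputable def subCoeff (α Λ T : ℝ) : ℝ :=
  (((1 / 4) ^ detachExp α) ^ α / (4 * (2 * Λ + T))) ^ (1 / (1 - α))

theorem subCoeff_pos {α Λ T : ℝ} (hΛ : 0 < Λ) (hT : 0 < T) : 0 < subCoeff α Λ T := by
  unfold subCoeff; positivity

theorem subCoeff_le {α Λ T : ℝ} (hα0 : 0 < α) (hα1 : α < 1) (hΛ : 0 < Λ) (hT : 0 < T) :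
    subCoeff α Λ T ≤ (1 / Λ) ^ (1 / (1 - α)) := by
  have hm := detachExp_pos hα1
  have h1 : (0 : ℝ) < 1 - α := by linarith
  unfold subCoeff
  have h2 : ((1 / 4 : ℝ) ^ detachExp α) ^ α ≤ 1 :=
    Real.rpow_le_one (by positivity)
      (Real.rpow_le_one (by norm_num) (by norm_num) hm.le) hα0.le
  gcongr
  linarith

/-- Keep only `s` in `(t / 4, t / 2]`, an interval of length `t / 4`. There the kernel is at least
`t / (2 * Λ + T)` and the power at least its value at `t / 4`; `subCoeff` is the coefficient for
which these losses balance. -/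
theorem kernelOp_sub {α Λ T : ℝ} (hα0 : 0 < α) (hα1 : α < 1) (hΛ : 0 < Λ) (hT : 0 < T) :
    (Ioc 0 T).indicator (fun t => ENNReal.ofReal (subCoeff α Λ T * t ^ detachExp α)) ≤
      kernelOp α Λ
        ((Ioc 0 T).indicator fun t => ENNReal.ofReal (subCoeff α Λ T * t ^ detachExp α)) := by
  intro t
  by_cases htT : t ∈ Ioc 0 T
  swap
  · rw [indicator_of_notMem htT]; exact zero_le
  have ht : 0 < t := htT.1
  set a := subCoeff α Λ T with ha
  have ha0 : 0 < a := subCoeff_pos hΛ hT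
  have hm := detachExp_pos hα1
  set C : ℝ := t / (2 * Λ + T) * (a * (t / 4) ^ detachExp α) ^ α with hC
  have hC0 : 0 ≤ C := by positivity
  rw [indicator_of_mem htT]
  calc ENNReal.ofReal (a * t ^ detachExp α) = ENNReal.ofReal (C * (t / 4)) := by
        congr 1
        have e : (t / 4) ^ detachExp α = t ^ detachExp α * (1 / 4) ^ detachExp α := by
          rw [← Real.mul_rpow ht.le (by norm_num)]; congr 1; ring
        rw [hC, Real.mul_rpow ha0.le (by positivity), e,
          Real.mul_rpow (by positivity) (by positivity)]
        calc a * t ^ detachExp α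
            = ((((1 / 4) ^ detachExp α) ^ α / (4 * (2 * Λ + T))) * a ^ α) *
              ((t ^ detachExp α) ^ α * t ^ 2) := by
              rw [rpow_detachExp_mul hα1 ht, ha, subCoeff,
                rpow_inv_one_sub hα1 (by positivity)]
          _ = _ := by field_simp
    _ = ∫⁻ s in Ioc (t / 4) (t / 2), ENNReal.ofReal C := by
        rw [setLIntegral_const, Real.volume_Ioc, ENNReal.ofReal_mul hC0]
        congr 2
        ring
    _ ≤ ∫⁻ s in Ioc (t / 4) (t / 2), ENNReal.ofReal (1 - Real.exp (-(t - s) / Λ)) *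
          ((Ioc 0 T).indicator (fun t => ENNReal.ofReal (a * t ^ detachExp α)) s) ^ α := by
        refine setLIntegral_mono' measurableSet_Ioc fun s hs => ?_
        have hs1 := hs.1
        have hs2 := hs.2
        have hs0 : 0 < s := by linarith
        rw [indicator_of_mem (show s ∈ Ioc 0 T from ⟨hs0, by linarith [htT.2]⟩), hC,
          ENNReal.ofReal_mul (by have := htT.2; positivity),
          ENNReal.ofReal_rpow_of_nonneg (by positivity) hα0.le]
        gcongr
        have h1 : Real.exp (-(t - s) / Λ) ≤ Real.exp (-(t / (2 * Λ))) := by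
          rw [Real.exp_le_exp, div_le_iff₀ hΛ]
          have : -(t / (2 * Λ)) * Λ = -(t / 2) := by field_simp
          rw [this]; linarith
        have h2 : Real.exp (-(t / (2 * Λ))) ≤ 1 / (1 + t / (2 * Λ)) := by
          rw [Real.exp_neg, one_div]
          gcongr
          linarith [Real.add_one_le_exp (t / (2 * Λ))]
        have h3 : 1 - 1 / (1 + t / (2 * Λ)) = t / (2 * Λ + t) := by
          have : 2 * Λ + t ≠ 0 := by positivity
          field_simp; ring
        have h4 : t / (2 * Λ + T) ≤ t / (2 * Λ + t) := by gcongr; exact htT.2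
        linarith
    _ ≤ _ := lintegral_mono_set fun s hs => lt_of_lt_of_le (by linarith : 0 < t / 4) hs.1.le

/-- A fixed point of `kernelOp` with two-sided power bounds. -/
theorem exists_fixed_kernelOp {α Λ : ℝ} (hα0 : 0 < α) (hα1 : α < 1) (hΛ : 0 < Λ) :
    ∃ f : ℝ → ℝ≥0∞, kernelOp α Λ f = f ∧
      (∀ t, f t ≤ ENNReal.ofReal ((1 / Λ) ^ (1 / (1 - α)) * t ^ detachExp α)) ∧
      ∀ T > 0, ∀ t ∈ Ioc 0 T, ENNReal.ofReal (subCoeff α Λ T * t ^ detachExp α) ≤ f t := by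
  set W : ℝ → ℝ≥0∞ := fun t => ENNReal.ofReal ((1 / Λ) ^ (1 / (1 - α)) * t ^ detachExp α) with hW
  -- Zero is a fixed point too, hence the greatest one is taken. The cap `W` keeps it finite, and
  -- being a supersolution it drops out of the fixed-point equation afterwards.
  let F : (ℝ → ℝ≥0∞) →o (ℝ → ℝ≥0∞) :=
    ⟨fun f => W ⊓ kernelOp α Λ f, fun f g h => inf_le_inf_left _ (kernelOp_mono hα0.le h)⟩
  have hfix : W ⊓ kernelOp α Λ F.gfp = F.gfp := F.map_gfp
  have hle : F.gfp ≤ W := by rw [← hfix]; exact inf_le_left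
  refine ⟨F.gfp, ?_, hle, ?_⟩
  · rw [inf_eq_right.2] at hfix
    · exact hfix
    · exact (kernelOp_mono hα0.le hle).trans (kernelOp_super hα0 hα1 hΛ)
  · intro T hT t ht
    have h : (Ioc 0 T).indicator (fun t => ENNReal.ofReal (subCoeff α Λ T * t ^ detachExp α)) ≤
        F.gfp := by
      refine F.le_gfp (le_inf ?_ (kernelOp_sub hα0 hα1 hΛ hT))
      refine indicator_le fun s hs => ENNReal.ofReal_le_ofReal ?_
      have := subCoeff_le hα0 hα1 hΛ hT
      have hs0 := hs.1
      gcongr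
    have := h t
    rwa [indicator_of_mem ht] at this

/-- `U` is a solution of `Λ U'' + U' = U ^ α` on the line with derivative `V`, vanishing on
`(-∞, 0]` and positive on `(0, ∞)`. -/
structure IsUniversalProfile (α Λ : ℝ) (U V : ℝ → ℝ) : Prop where
  hasDerivAt : ∀ t, HasDerivAt U (V t) t
  hasDerivAt_deriv : ∀ t, HasDerivAt V ((U t ^ α - V t) / Λ) t
  eq_zero : ∀ t ≤ 0, U t = 0
  deriv_eq_zero : ∀ t ≤ 0, V t = 0
  upper : ∃ A, ∀ t, 0 < t → U t ≤ A * t ^ detachExp α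
  lower : ∀ T > 0, ∃ a > 0, ∀ t ∈ Ioc 0 T, a * t ^ detachExp α ≤ U t

/-- The fixed point is monotone, hence measurable with locally integrable power. Splitting the
kernel as `1 - exp (-t / Λ) * exp (s / Λ)` writes `U` through two primitives, so `U` is continuous,
and the fundamental theorem of calculus then yields the equation. -/
theorem exists_isUniversalProfile {α Λ : ℝ} (hα0 : 0 < α) (hα1 : α < 1) (hΛ : 0 < Λ) :
    ∃ U V, IsUniversalProfile α Λ U V := by
  obtain ⟨f, hf, hfW, hfa⟩ := exists_fixed_kernelOp hα0 hα1 hΛ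
  have hfin : ∀ t, f t ≠ ∞ := fun t => ((hfW t).trans_lt ENNReal.ofReal_lt_top).ne
  have hmono : Monotone f := by rw [← hf]; exact kernelOp_apply_mono hΛ f
  set U : ℝ → ℝ := fun t => (f t).toReal with hU
  have hU0 : ∀ t, 0 ≤ U t := fun t => ENNReal.toReal_nonneg
  have hUmono : Monotone U := fun s t h => ENNReal.toReal_mono (hfin t) (hmono h)
  have hUneg : ∀ t ≤ 0, U t = 0 := by
    intro t ht
    rw [hU, ← hf]
    simp only [kernelOp_eq_zero hΛ f ht, ENNReal.toReal_zero]
  have hPmono : Monotone fun t => U t ^ α := fun s t h =>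
    Real.rpow_le_rpow (hU0 s) (hUmono h) hα0.le
  have hPint : ∀ a b, IntervalIntegrable (fun t => U t ^ α) volume a b :=
    fun a b => hPmono.intervalIntegrable
  have hEint : ∀ a b, IntervalIntegrable (fun t => Real.exp (t / Λ) * U t ^ α) volume a b :=
    fun a b => (hPint a b).continuousOn_mul (by fun_prop)
  have hform : ∀ t, U t = (∫ s in (0 : ℝ)..t, U s ^ α) -
      Real.exp (-t / Λ) * ∫ s in (0 : ℝ)..t, Real.exp (s / Λ) * U s ^ α := by
    intro t
    rw [← intervalIntegral.integral_const_mul,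
      ← intervalIntegral.integral_sub (hPint 0 t) ((hEint 0 t).const_mul _)]
    have e : ∀ s, U s ^ α - Real.exp (-t / Λ) * (Real.exp (s / Λ) * U s ^ α) =
        (1 - Real.exp (-(t - s) / Λ)) * U s ^ α := by
      intro s
      have : -(t - s) / Λ = -t / Λ + s / Λ := by ring
      rw [this, Real.exp_add]; ring
    simp only [e]
    rcases le_or_gt t 0 with ht | ht
    · rw [hUneg t ht, intervalIntegral.integral_symm]
      rw [intervalIntegral.integral_congr (g := fun _ => 0)]
      · simp
      · intro s hs
        rw [uIcc_of_le ht] at hs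
        simp [hUneg s hs.2, Real.zero_rpow hα0.ne']
    · have h1 : U t = (∫⁻ s in Ioc 0 t, ENNReal.ofReal
          ((1 - Real.exp (-(t - s) / Λ)) * U s ^ α)).toReal := by
        conv_lhs => rw [hU, ← hf]
        simp only [kernelOp]
        congr 1
        rw [← lintegral_indicator measurableSet_Ioi, ← lintegral_indicator measurableSet_Ioc]
        refine lintegral_congr fun s => ?_
        by_cases hs0 : 0 < s
        · rw [indicator_of_mem (show s ∈ Ioi 0 from hs0)]
          by_cases hst : s ≤ t
          · rw [indicator_of_mem (show s ∈ Ioc 0 t from ⟨hs0, hst⟩), ENNReal.ofReal_mul,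
              ← ENNReal.ofReal_rpow_of_nonneg (hU0 s) hα0.le, ENNReal.ofReal_toReal (hfin s)]
            have : -(t - s) / Λ ≤ 0 := div_nonpos_of_nonpos_of_nonneg (by linarith) hΛ.le
            linarith [Real.exp_le_one_iff.2 this]
          · rw [indicator_of_notMem (fun h => hst h.2), kernel_eq_zero hΛ (by linarith), zero_mul]
        · rw [indicator_of_notMem (show s ∉ Ioi 0 from hs0),
            indicator_of_notMem (fun h => hs0 h.1)]
      rw [h1, intervalIntegral.integral_of_le ht.le, integral_eq_lintegral_of_nonneg_ae]
      · filter_upwards [ae_restrict_mem measurableSet_Ioc] with s hs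
        have : -(t - s) / Λ ≤ 0 := div_nonpos_of_nonpos_of_nonneg (by linarith [hs.2]) hΛ.le
        have := Real.exp_le_one_iff.2 this
        exact mul_nonneg (by linarith) (Real.rpow_nonneg (hU0 s) _)
      · exact (Measurable.mul (by fun_prop) hPmono.measurable).aestronglyMeasurable
  have hUcont : Continuous U := by
    rw [funext hform]
    have h1 := intervalIntegral.continuous_primitive hPint 0
    have h2 := intervalIntegral.continuous_primitive hEint 0
    fun_prop
  have hPcont : Continuous fun t => U t ^ α := hUcont.rpow_const fun _ => Or.inr hα0.le
  have hd1 : ∀ t, HasDerivAt (fun t => ∫ s in (0 : ℝ)..t, U s ^ α) (U t ^ α) t :=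
    fun t => hPcont.integral_hasStrictDerivAt 0 t |>.hasDerivAt
  have hd2 : ∀ t, HasDerivAt (fun t => ∫ s in (0 : ℝ)..t, Real.exp (s / Λ) * U s ^ α)
      (Real.exp (t / Λ) * U t ^ α) t := by
    have : Continuous fun s => Real.exp (s / Λ) * U s ^ α := by fun_prop
    exact fun t => this.integral_hasStrictDerivAt 0 t |>.hasDerivAt
  have hde : ∀ t, HasDerivAt (fun t => Real.exp (-t / Λ)) (Real.exp (-t / Λ) * (-1 / Λ)) t :=
    fun t => ((hasDerivAt_neg t).div_const Λ).exp
  have hee : ∀ t, Real.exp (-t / Λ) * Real.exp (t / Λ) = 1 := fun t => by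
    rw [← Real.exp_add, ← add_div]; simp
  refine ⟨U, fun t => 1 / Λ * (Real.exp (-t / Λ) *
    ∫ s in (0 : ℝ)..t, Real.exp (s / Λ) * U s ^ α), ?_, ?_, hUneg, ?_, ?_, ?_⟩
  · intro t
    have := (hd1 t).sub ((hde t).mul (hd2 t))
    refine (this.congr_of_eventuallyEq (Eventually.of_forall hform)).congr_deriv ?_
    linear_combination (-(U t ^ α)) * hee t
  · intro t
    have := ((hde t).mul (hd2 t)).const_mul (1 / Λ)
    exact this.congr_deriv (by linear_combination (U t ^ α / Λ) * hee t)
  · intro t ht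
    rw [intervalIntegral.integral_congr (g := fun _ => 0)]
    · simp
    · intro s hs
      rw [uIcc_of_ge ht] at hs
      simp [hUneg s hs.2, Real.zero_rpow hα0.ne']
  · refine ⟨_, fun t ht => ENNReal.toReal_le_of_le_ofReal (by positivity) (hfW t)⟩
  · intro T hT
    refine ⟨_, subCoeff_pos hΛ hT (α := α), fun t ht => ?_⟩
    exact (ENNReal.ofReal_le_iff_le_toReal (hfin t)).1 (hfa T hT t ht)

/-! ### Monotonicity, convexity and log-concavity of the profile. -/

theorem pos_of_relaxation {Λ : ℝ} {f f' : ℝ → ℝ} (hΛ : 0 < Λ) (hc : ContinuousOn f (Ici 0))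
    (h0 : 0 ≤ f 0) (hd : ∀ t > 0, HasDerivAt f (f' t) t) (hpos : ∀ t > 0, 0 < Λ * f' t + f t)
    {t : ℝ} (ht : 0 < t) : 0 < f t := by
  have hmono : StrictMonoOn (fun t => Real.exp (t / Λ) * f t) (Ici 0) := by
    refine strictMonoOn_of_hasDerivWithinAt_pos (convex_Ici 0)
      (f' := fun t => Real.exp (t / Λ) * (1 / Λ) * f t + Real.exp (t / Λ) * f' t)
      (ContinuousOn.mul (by fun_prop) hc) (fun s hs => ?_) (fun s hs => ?_)
    · rw [interior_Ici] at hs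
      exact (((hasDerivAt_id s).div_const Λ).exp.mul (hd s hs)).hasDerivWithinAt
    · rw [interior_Ici] at hs
      have e : Real.exp (s / Λ) * (1 / Λ) * f s + Real.exp (s / Λ) * f' s =
          Real.exp (s / Λ) / Λ * (Λ * f' s + f s) := by field_simp; ring
      rw [e]
      exact mul_pos (by positivity) (hpos s hs)
  have := hmono self_mem_Ici ht.le ht
  simp only [zero_div, Real.exp_zero, one_mul] at this
  exact pos_of_mul_pos_right (h0.trans_lt this) (Real.exp_pos _).le

namespace IsUniversalProfile

variable {α Λ : ℝ} {U V : ℝ → ℝ}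

theorem pos (h : IsUniversalProfile α Λ U V) {t : ℝ} (ht : 0 < t) : 0 < U t := by
  obtain ⟨a, ha, hle⟩ := h.lower t ht
  exact (mul_pos ha (Real.rpow_pos_of_pos ht _)).trans_le (hle t ⟨ht, le_rfl⟩)

theorem nonneg (h : IsUniversalProfile α Λ U V) (t : ℝ) : 0 ≤ U t := by
  rcases le_or_gt t 0 with ht | ht
  · exact (h.eq_zero t ht).ge
  · exact (h.pos ht).le

theorem continuous (h : IsUniversalProfile α Λ U V) : Continuous U :=
  continuous_iff_continuousAt.2 fun t => (h.hasDerivAt t).continuousAt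

theorem continuous_deriv (h : IsUniversalProfile α Λ U V) : Continuous V :=
  continuous_iff_continuousAt.2 fun t => (h.hasDerivAt_deriv t).continuousAt

theorem deriv_pos (h : IsUniversalProfile α Λ U V) (hΛ : 0 < Λ) {t : ℝ} (ht : 0 < t) :
    0 < V t := by
  refine pos_of_relaxation hΛ h.continuous_deriv.continuousOn (h.deriv_eq_zero 0 le_rfl).ge
    (fun s _ => h.hasDerivAt_deriv s) (fun s hs => ?_) ht
  have : Λ * ((U s ^ α - V s) / Λ) + V s = U s ^ α := by field_simp; ring
  rw [this]
  exact Real.rpow_pos_of_pos (h.pos hs) _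

theorem hasDerivAt_deriv_deriv (h : IsUniversalProfile α Λ U V) {t : ℝ} (ht : 0 < t) :
    HasDerivAt (fun t => (U t ^ α - V t) / Λ)
      ((α * U t ^ (α - 1) * V t - (U t ^ α - V t) / Λ) / Λ) t := by
  have := (((h.hasDerivAt t).rpow_const (p := α) (Or.inl (h.pos ht).ne')).sub
    (h.hasDerivAt_deriv t)).div_const Λ
  exact this.congr_deriv (by ring)

theorem continuous_deriv_deriv (h : IsUniversalProfile α Λ U V) (hα : 0 < α) :
    Continuous fun t => (U t ^ α - V t) / Λ := by
  have := h.continuous.rpow_const (p := α) fun _ => Or.inr hα.le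
  have := h.continuous_deriv
  fun_prop

/-- Differentiating the equation for `t > 0` gives `Λ U''' + U'' = α U ^ (α - 1) V > 0`, and `U''`
vanishes at `0`. -/
theorem deriv_deriv_pos (h : IsUniversalProfile α Λ U V) (hα : 0 < α) (hΛ : 0 < Λ) {t : ℝ}
    (ht : 0 < t) : 0 < (U t ^ α - V t) / Λ := by
  refine pos_of_relaxation hΛ (h.continuous_deriv_deriv hα).continuousOn ?_
    (fun s hs => h.hasDerivAt_deriv_deriv hs) (fun s hs => ?_) ht
  · rw [h.eq_zero 0 le_rfl, h.deriv_eq_zero 0 le_rfl, Real.zero_rpow hα.ne']; simp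
  · have : Λ * ((α * U s ^ (α - 1) * V s - (U s ^ α - V s) / Λ) / Λ) + (U s ^ α - V s) / Λ =
        α * U s ^ (α - 1) * V s := by field_simp; ring
    rw [this]
    have := h.pos hs
    have := h.deriv_pos hΛ hs
    positivity

/-- `U U'' < U' ^ 2`: the profile is logarithmically strictly concave. -/
theorem mul_deriv_deriv_lt (h : IsUniversalProfile α Λ U V) (hα0 : 0 < α) (hα1 : α < 1)
    (hΛ : 0 < Λ) {t : ℝ} (ht : 0 < t) : U t * ((U t ^ α - V t) / Λ) < V t ^ 2 := by
  -- For `f = k V ^ 2 - U U''` one finds `Λ f' + f = (2 k - 1 - α) V U ^ α + (1 - k) V ^ 2`. The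
  -- choice `k = (1 + α) / 2` removes the mixed term.
  have key : 0 < (1 + α) / 2 * V t ^ 2 - U t * ((U t ^ α - V t) / Λ) := by
    refine pos_of_relaxation hΛ (f := fun t => (1 + α) / 2 * V t ^ 2 - U t * ((U t ^ α - V t) / Λ))
      (f' := fun t => (1 + α) / 2 * (2 * V t * ((U t ^ α - V t) / Λ)) -
        (V t * ((U t ^ α - V t) / Λ) +
          U t * ((α * U t ^ (α - 1) * V t - (U t ^ α - V t) / Λ) / Λ)))
      ?_ ?_ (fun s hs => ?_) (fun s hs => ?_) ht
    · exact (((h.continuous_deriv.pow 2).const_mul _).sub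
        (h.continuous.mul (h.continuous_deriv_deriv hα0))).continuousOn
    · simp [h.eq_zero 0 le_rfl, h.deriv_eq_zero 0 le_rfl]
    · have := (((h.hasDerivAt_deriv s).pow 2).const_mul ((1 + α) / 2)).sub
        ((h.hasDerivAt s).mul (h.hasDerivAt_deriv_deriv hs))
      exact this.congr_deriv (by norm_num)
    · have hU := h.pos hs
      have hV := h.deriv_pos hΛ hs
      have e : U s * U s ^ (α - 1) = U s ^ α := by
        rw [Real.rpow_sub_one hU.ne']; field_simp
      have : Λ * ((1 + α) / 2 * (2 * V s * ((U s ^ α - V s) / Λ)) -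
          (V s * ((U s ^ α - V s) / Λ) +
            U s * ((α * U s ^ (α - 1) * V s - (U s ^ α - V s) / Λ) / Λ))) +
          ((1 + α) / 2 * V s ^ 2 - U s * ((U s ^ α - V s) / Λ)) = (1 - α) / 2 * V s ^ 2 := by
        field_simp
        linear_combination (-(2 * α * V s * Λ)) * e
      rw [this]
      exact mul_pos (by linarith) (by positivity)
  have := h.deriv_pos hΛ ht
  have : 0 < (1 - α) / 2 * V t ^ 2 := mul_pos (by linarith) (by positivity)
  linarith

/-! ### The initial value as a function of the travel time. -/

theorem denom_pos (h : IsUniversalProfile α Λ U V) (hΛ : 0 < Λ) {t : ℝ} (ht : 0 < t) :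
    0 < Λ * V t + U t :=
  add_pos (mul_pos hΛ (h.deriv_pos hΛ ht)) (h.pos ht)

theorem continuousOn_ratio (h : IsUniversalProfile α Λ U V) (hΛ : 0 < Λ) :
    ContinuousOn (fun t => U t / (Λ * V t + U t)) (Ioi 0) := by
  have h1 := h.continuous
  have h2 := h.continuous_deriv
  exact ContinuousOn.div (by fun_prop) (by fun_prop) fun t ht => (h.denom_pos hΛ ht).ne'

/-- The initial value attained after normalisation is strictly increasing in the travel time. -/
theorem strictMonoOn_ratio (h : IsUniversalProfile α Λ U V) (hα0 : 0 < α) (hα1 : α < 1)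
    (hΛ : 0 < Λ) : StrictMonoOn (fun t => U t / (Λ * V t + U t)) (Ioi 0) := by
  refine strictMonoOn_of_hasDerivWithinAt_pos (convex_Ioi 0)
      (f' := fun t => (V t * (Λ * V t + U t) -
        U t * (Λ * ((U t ^ α - V t) / Λ) + V t)) / (Λ * V t + U t) ^ 2)
      (h.continuousOn_ratio hΛ) (fun s hs => ?_) (fun s hs => ?_)
  · rw [interior_Ioi] at hs
    exact ((h.hasDerivAt s).div (((h.hasDerivAt_deriv s).const_mul Λ).add (h.hasDerivAt s))
      (h.denom_pos hΛ hs).ne').hasDerivWithinAt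
  · rw [interior_Ioi] at hs
    have h1 := h.denom_pos hΛ hs
    have h2 := h.mul_deriv_deriv_lt hα0 hα1 hΛ hs
    refine div_pos ?_ (by positivity)
    have : V s * (Λ * V s + U s) - U s * (Λ * ((U s ^ α - V s) / Λ) + V s) =
        Λ * (V s ^ 2 - U s * ((U s ^ α - V s) / Λ)) := by ring
    rw [this]
    exact mul_pos hΛ (by linarith)

theorem hasDerivAt_exp_neg_mul (h : IsUniversalProfile α Λ U V) (β t : ℝ) :
    HasDerivAt (fun t => Real.exp (-β * t) * U t) (Real.exp (-β * t) * (V t - β * U t)) t := by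
  have := (((hasDerivAt_id t).const_mul (-β)).exp).mul (h.hasDerivAt t)
  exact this.congr_deriv (by simp only [id]; ring)

/-- Otherwise `V ≤ β U` with `β = (1 - y) / (Λ y)`, so `exp (-β t) * U t` would be nonincreasing
from `0`, contradicting positivity of `U`. -/
theorem exists_ratio_lt (h : IsUniversalProfile α Λ U V) (hΛ : 0 < Λ) {y : ℝ} (hy : 0 < y) :
    ∃ t > 0, U t / (Λ * V t + U t) ≤ y := by
  by_contra! hcon
  have hle : ∀ t > 0, V t - ((1 - y) / (Λ * y)) * U t ≤ 0 := by
    intro t ht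
    have := hcon t ht
    rw [lt_div_iff₀ (h.denom_pos hΛ ht)] at this
    rw [sub_nonpos, div_mul_eq_mul_div, le_div_iff₀ (by positivity)]
    linarith
  have hanti : AntitoneOn (fun t => Real.exp (-((1 - y) / (Λ * y)) * t) * U t) (Ici 0) := by
    refine antitoneOn_of_hasDerivWithinAt_nonpos (convex_Ici 0)
      (fun t _ => (h.hasDerivAt_exp_neg_mul _ t).continuousAt.continuousWithinAt)
      (fun t _ => (h.hasDerivAt_exp_neg_mul _ t).hasDerivWithinAt) (fun t ht => ?_)
    rw [interior_Ici] at ht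
    exact mul_nonpos_of_nonneg_of_nonpos (Real.exp_pos _).le (hle t ht)
  have := hanti self_mem_Ici (mem_Ici.2 zero_le_one : (1 : ℝ) ∈ Ici 0) zero_le_one
  simp only [h.eq_zero 0 le_rfl, mul_zero] at this
  have := mul_pos (Real.exp_pos (-((1 - y) / (Λ * y)) * 1)) (h.pos one_pos)
  linarith

/-- Otherwise `V ≥ β U` with `β > 0`, so `U` would grow exponentially, against its power-law upper
bound. -/
theorem exists_lt_ratio (h : IsUniversalProfile α Λ U V) (hΛ : 0 < Λ) {y : ℝ} (hy : 0 < y)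
    (hy1 : y < 1) : ∃ t > 0, y ≤ U t / (Λ * V t + U t) := by
  by_contra! hcon
  set β := (1 - y) / (Λ * y) with hβ
  have hβ0 : 0 < β := div_pos (by linarith) (by positivity)
  have hle : ∀ t > 0, 0 ≤ V t - β * U t := by
    intro t ht
    have := hcon t ht
    rw [div_lt_iff₀ (h.denom_pos hΛ ht)] at this
    rw [sub_nonneg, hβ, div_mul_eq_mul_div, div_le_iff₀ (by positivity)]
    linarith
  have hmono : MonotoneOn (fun t => Real.exp (-β * t) * U t) (Ici 0) := by
    refine monotoneOn_of_hasDerivWithinAt_nonneg (convex_Ici 0)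
      (fun t _ => (h.hasDerivAt_exp_neg_mul _ t).continuousAt.continuousWithinAt)
      (fun t _ => (h.hasDerivAt_exp_neg_mul _ t).hasDerivWithinAt) (fun t ht => ?_)
    rw [interior_Ici] at ht
    exact mul_nonneg (Real.exp_pos _).le (hle t ht)
  obtain ⟨A, hA⟩ := h.upper
  have hlim := tendsto_exp_mul_div_rpow_atTop (detachExp α) β hβ0
  set K := Real.exp (-β * 1) * U 1 with hK
  have hK0 : 0 < K := mul_pos (Real.exp_pos _) (h.pos one_pos)
  obtain ⟨t, ht, ht1⟩ := ((hlim.eventually_gt_atTop (A / K)).and (eventually_ge_atTop 1)).exists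
  have ht0 : 0 < t := by linarith
  have h1 : K ≤ Real.exp (-β * t) * U t :=
    hmono (mem_Ici.2 zero_le_one : (1 : ℝ) ∈ Ici 0) ht0.le ht1
  have hp : 0 < t ^ detachExp α := Real.rpow_pos_of_pos ht0 _
  rw [lt_div_iff₀ hp, div_mul_eq_mul_div, div_lt_iff₀ hK0] at ht
  have h2 : Real.exp (β * t) * K ≤ U t := by
    calc Real.exp (β * t) * K ≤ Real.exp (β * t) * (Real.exp (-β * t) * U t) := by gcongr
      _ = U t := by rw [← mul_assoc, ← Real.exp_add]; simp
  linarith [hA t ht0]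

theorem exists_ratio_eq (h : IsUniversalProfile α Λ U V) (hΛ : 0 < Λ) {y : ℝ} (hy : 0 < y)
    (hy1 : y < 1) : ∃ t > 0, U t / (Λ * V t + U t) = y := by
  obtain ⟨a, ha, hay⟩ := h.exists_ratio_lt hΛ hy
  obtain ⟨b, hb, hby⟩ := h.exists_lt_ratio hΛ hy hy1
  obtain ⟨t, ht, hty⟩ := isPreconnected_Ioi.intermediate_value ha hb (h.continuousOn_ratio hΛ)
    ⟨hay, hby⟩
  exact ⟨t, ht, hty⟩

theorem contDiff_one (h : IsUniversalProfile α Λ U V) : ContDiff ℝ 1 U := by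
  rw [contDiff_one_iff_deriv]
  refine ⟨fun t => (h.hasDerivAt t).differentiableAt, ?_⟩
  rw [show deriv U = V from funext fun t => (h.hasDerivAt t).deriv]
  exact h.continuous_deriv

theorem contDiffOn (h : IsUniversalProfile α Λ U V) :
    ContDiffOn ℝ ((⊤ : ℕ∞) : WithTop ℕ∞) U (Ioi 0) := by
  have hU : deriv U = V := funext fun t => (h.hasDerivAt t).deriv
  have hV : deriv V = fun t => (U t ^ α - V t) / Λ :=
    funext fun t => (h.hasDerivAt_deriv t).deriv
  have key : ∀ n : ℕ, ContDiffOn ℝ n U (Ioi 0) ∧ ContDiffOn ℝ n V (Ioi 0) := by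
    intro n
    induction n with
    | zero =>
      simp only [Nat.cast_zero, contDiffOn_zero]
      exact ⟨h.continuous.continuousOn, h.continuous_deriv.continuousOn⟩
    | succ n ih =>
      push_cast
      rw [contDiffOn_succ_iff_deriv_of_isOpen isOpen_Ioi,
        contDiffOn_succ_iff_deriv_of_isOpen isOpen_Ioi, hU, hV]
      refine ⟨⟨fun t _ => (h.hasDerivAt t).differentiableAt.differentiableWithinAt,
          by simp, ih.2⟩,
        fun t _ => (h.hasDerivAt_deriv t).differentiableAt.differentiableWithinAt, by simp, ?_⟩
      exact ((ih.1.rpow_const_of_ne fun t ht => (h.pos ht).ne').sub ih.2).div_const Λ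
  exact contDiffOn_infty.2 fun n => (key n).1

end IsUniversalProfile

/-! ### Comparison and uniqueness for solutions starting from rest. -/

theorem nonneg_of_relaxation {Λ b : ℝ} {f f' : ℝ → ℝ} (hΛ : 0 < Λ)
    (hc : ContinuousOn f (Icc 0 b)) (h0 : 0 ≤ f 0) (hd : ∀ t ∈ Ioo 0 b, HasDerivAt f (f' t) t)
    (hpos : ∀ t ∈ Ioo 0 b, 0 ≤ Λ * f' t + f t) {t : ℝ} (ht : t ∈ Icc 0 b) : 0 ≤ f t := by
  have hmono : MonotoneOn (fun t => Real.exp (t / Λ) * f t) (Icc 0 b) := by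
    refine monotoneOn_of_hasDerivWithinAt_nonneg (convex_Icc 0 b)
      (f' := fun t => Real.exp (t / Λ) * (1 / Λ) * f t + Real.exp (t / Λ) * f' t)
      (ContinuousOn.mul (by fun_prop) hc) (fun s hs => ?_) (fun s hs => ?_)
    · rw [interior_Icc] at hs
      exact (((hasDerivAt_id s).div_const Λ).exp.mul (hd s hs)).hasDerivWithinAt
    · rw [interior_Icc] at hs
      have e : Real.exp (s / Λ) * (1 / Λ) * f s + Real.exp (s / Λ) * f' s =
          Real.exp (s / Λ) / Λ * (Λ * f' s + f s) := by field_simp; ring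
      rw [e]
      exact mul_nonneg (by positivity) (hpos s hs)
  have := hmono (left_mem_Icc.2 (ht.1.trans ht.2)) ht ht.1
  simp only [zero_div, Real.exp_zero, one_mul] at this
  exact nonneg_of_mul_nonneg_right (h0.trans this) (Real.exp_pos _)

/-- `u` is a nonnegative solution of `Λ u'' + u' = u ^ α` on `[0, T]` with derivative `u'`. -/
structure IsOrbit (α Λ T : ℝ) (u u' : ℝ → ℝ) : Prop where
  continuousOn : ContinuousOn u (Icc 0 T)
  continuousOn_deriv : ContinuousOn u' (Icc 0 T)
  hasDerivAt : ∀ t ∈ Ioo 0 T, HasDerivAt u (u' t) t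
  hasDerivAt_deriv : ∀ t ∈ Ioo 0 T, HasDerivAt u' ((u t ^ α - u' t) / Λ) t
  nonneg : ∀ t ∈ Icc 0 T, 0 ≤ u t

theorem IsUniversalProfile.isOrbit {α Λ : ℝ} {U V : ℝ → ℝ} (h : IsUniversalProfile α Λ U V)
    (T : ℝ) : IsOrbit α Λ T U V where
  continuousOn := h.continuous.continuousOn
  continuousOn_deriv := h.continuous_deriv.continuousOn
  hasDerivAt t _ := h.hasDerivAt t
  hasDerivAt_deriv t _ := h.hasDerivAt_deriv t
  nonneg t _ := h.nonneg t

namespace IsOrbit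

variable {α Λ T : ℝ} {u u' w w' : ℝ → ℝ}

theorem mono (h : IsOrbit α Λ T u u') {S : ℝ} (hS : S ≤ T) : IsOrbit α Λ S u u' where
  continuousOn := h.continuousOn.mono (Icc_subset_Icc_right hS)
  continuousOn_deriv := h.continuousOn_deriv.mono (Icc_subset_Icc_right hS)
  hasDerivAt t ht := h.hasDerivAt t (Ioo_subset_Ioo_right hS ht)
  hasDerivAt_deriv t ht := h.hasDerivAt_deriv t (Ioo_subset_Ioo_right hS ht)
  nonneg t ht := h.nonneg t (Icc_subset_Icc_right hS ht)

theorem shift (h : IsOrbit α Λ T u u') {a : ℝ} (ha : 0 ≤ a) :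
    IsOrbit α Λ (T - a) (fun t => u (t + a)) (fun t => u' (t + a)) := by
  have h1 : MapsTo (fun t => t + a) (Icc 0 (T - a)) (Icc 0 T) := fun t ht =>
    ⟨by linarith [ht.1], by linarith [ht.2]⟩
  have h2 : MapsTo (fun t => t + a) (Ioo 0 (T - a)) (Ioo 0 T) := fun t ht =>
    ⟨by linarith [ht.1], by linarith [ht.2]⟩
  exact
    { continuousOn := h.continuousOn.comp (by fun_prop) h1
      continuousOn_deriv := h.continuousOn_deriv.comp (by fun_prop) h1
      hasDerivAt := fun t ht => (h.hasDerivAt _ (h2 ht)).comp_add_const t a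
      hasDerivAt_deriv := fun t ht => (h.hasDerivAt_deriv _ (h2 ht)).comp_add_const t a
      nonneg := fun t ht => h.nonneg _ (h1 ht) }

theorem deriv_nonneg (h : IsOrbit α Λ T u u') (hΛ : 0 < Λ) (h0 : 0 ≤ u' 0) {t : ℝ}
    (ht : t ∈ Icc 0 T) : 0 ≤ u' t := by
  refine nonneg_of_relaxation hΛ h.continuousOn_deriv h0 h.hasDerivAt_deriv (fun s hs => ?_) ht
  have : Λ * ((u s ^ α - u' s) / Λ) + u' s = u s ^ α := by field_simp; ring
  rw [this]
  exact Real.rpow_nonneg (h.nonneg s (Ioo_subset_Icc_self hs)) _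

theorem monotoneOn (h : IsOrbit α Λ T u u') (hΛ : 0 < Λ) (h0 : 0 ≤ u' 0) :
    MonotoneOn u (Icc 0 T) := by
  refine monotoneOn_of_hasDerivWithinAt_nonneg (convex_Icc 0 T) h.continuousOn
    (f' := u') (fun s hs => ?_) (fun s hs => ?_)
  · rw [interior_Icc] at hs
    exact (h.hasDerivAt s hs).hasDerivWithinAt
  · exact h.deriv_nonneg hΛ h0 (interior_subset hs)

/-- Up to a first contact, `d = w - u` satisfies `Λ d'' + d' ≥ 0`, so `d'` stays nonnegative and the
gap never falls below its positive initial value. -/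
theorem lt_of_lt (h : IsOrbit α Λ T u u') (k : IsOrbit α Λ T w w') (hα : 0 ≤ α) (hΛ : 0 < Λ)
    (h0 : u 0 < w 0) (h1 : u' 0 ≤ w' 0) {t : ℝ} (ht : t ∈ Icc 0 T) : u t < w t := by
  by_contra! hcon
  have hcpt : IsCompact {t ∈ Icc 0 T | w t - u t ∈ Iic 0} :=
    isCompact_Icc.of_isClosed_subset
      ((k.continuousOn.sub h.continuousOn).preimage_isClosed_of_isClosed isClosed_Icc isClosed_Iic)
      (sep_subset _ _)
  obtain ⟨b, ⟨hbT, hb⟩, hmin⟩ := hcpt.exists_isLeast ⟨t, ht, by simpa using hcon⟩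
  have hb : w b - u b ≤ 0 := hb
  have hlt : ∀ s ∈ Ico 0 b, u s < w s := by
    intro s hs
    by_contra! hws
    have := hmin ⟨⟨hs.1, hs.2.le.trans hbT.2⟩, by simpa using hws⟩
    linarith [hs.2]
  have h' := h.mono hbT.2
  have k' := k.mono hbT.2
  have hd : ∀ s ∈ Icc 0 b, 0 ≤ w' s - u' s := by
    intro s hs
    refine nonneg_of_relaxation hΛ (f := fun s => w' s - u' s)
      (k'.continuousOn_deriv.sub h'.continuousOn_deriv) (by simpa using h1)
      (fun r hr => (k'.hasDerivAt_deriv r hr).sub (h'.hasDerivAt_deriv r hr)) (fun r hr => ?_) hs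
    have : Λ * ((w r ^ α - w' r) / Λ - (u r ^ α - u' r) / Λ) + (w' r - u' r) =
        w r ^ α - u r ^ α := by field_simp; ring
    rw [this, sub_nonneg]
    exact Real.rpow_le_rpow (h'.nonneg r (Ioo_subset_Icc_self hr))
      (hlt r (Ioo_subset_Ico_self hr)).le hα
  have hmono : MonotoneOn (fun s => w s - u s) (Icc 0 b) := by
    refine monotoneOn_of_hasDerivWithinAt_nonneg (convex_Icc 0 b)
      (f' := fun s => w' s - u' s) (k'.continuousOn.sub h'.continuousOn)
      (fun s hs => ?_) (fun s hs => hd s (interior_subset hs))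
    rw [interior_Icc] at hs
    exact ((k'.hasDerivAt s hs).sub (h'.hasDerivAt s hs)).hasDerivWithinAt
  have := hmono (left_mem_Icc.2 hbT.1) (right_mem_Icc.2 hbT.1) hbT.1
  dsimp only at this
  linarith

/-- A solution positive after time zero dominates every other solution starting from rest. -/
theorem le_of_pos (h : IsOrbit α Λ T u u') (k : IsOrbit α Λ T w w') (hα : 0 ≤ α) (hΛ : 0 < Λ)
    (hu0 : u 0 = 0) (hu0' : u' 0 = 0) (hw0' : w' 0 = 0)
    (hw : ∀ t ∈ Ioc 0 T, 0 < w t) {t : ℝ} (ht : t ∈ Ico 0 T) : u t ≤ w t := by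
  have hT : 0 < T := ht.1.trans_lt ht.2
  have hlim : Tendsto w (𝓝[Ioo t T] t) (𝓝 (w t)) :=
    (k.continuousOn t ⟨ht.1, ht.2.le⟩).mono fun s hs => ⟨ht.1.trans hs.1.le, hs.2.le⟩
  have := left_nhdsWithin_Ioo_neBot ht.2
  refine ge_of_tendsto hlim ?_
  filter_upwards [self_mem_nhdsWithin] with s hs
  -- Advancing `w` by `s - t` puts it strictly above `u` at time zero, so strict comparison applies;
  -- then `s` tends to `t`.
  have hε : 0 < s - t := sub_pos.2 hs.1
  have hεT : s - t < T := by linarith [hs.2, ht.1]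
  have := (h.mono (sub_le_self T hε.le)).lt_of_lt (k.shift hε.le) hα hΛ (t := t)
    (by simpa [hu0] using hw (s - t) ⟨hε, hεT.le⟩)
    (by
      simp only [hu0', zero_add]
      exact k.deriv_nonneg hΛ hw0'.ge ⟨hε.le, hεT.le⟩)
    ⟨ht.1, by linarith [hs.2]⟩
  simpa using this.le

theorem eqOn_of_pos (h : IsOrbit α Λ T u u') (k : IsOrbit α Λ T w w') (hα : 0 ≤ α) (hΛ : 0 < Λ)
    (hT : 0 < T) (hu0 : u 0 = 0) (hu0' : u' 0 = 0) (hw0 : w 0 = 0) (hw0' : w' 0 = 0)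
    (hu : ∀ t ∈ Ioc 0 T, 0 < u t) (hw : ∀ t ∈ Ioc 0 T, 0 < w t) :
    EqOn u w (Icc 0 T) ∧ EqOn u' w' (Icc 0 T) := by
  have h1 : EqOn u w (Ico 0 T) := fun t ht =>
    le_antisymm (h.le_of_pos k hα hΛ hu0 hu0' hw0' hw ht) (k.le_of_pos h hα hΛ hw0 hw0' hu0' hu ht)
  refine ⟨h1.of_subset_closure h.continuousOn k.continuousOn Ico_subset_Icc_self
    (closure_Ico hT.ne).ge, ?_⟩
  have h2 : EqOn u' w' (Ioo 0 T) := fun t ht =>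
    (h.hasDerivAt t ht).unique ((k.hasDerivAt t ht).congr_of_eventuallyEq
      (by filter_upwards [Ioo_mem_nhds ht.1 ht.2] with s hs using h1 (Ioo_subset_Ico_self hs)))
  exact h2.of_subset_closure h.continuousOn_deriv k.continuousOn_deriv Ioo_subset_Icc_self
    (closure_Ioo hT.ne).ge

end IsOrbit

/-- A smooth function vanishing to the left of `a` is flat at `a`. -/
theorem exists_flat_bound {a b T : ℝ} (ha : 0 < a) (hab : a < b) (hbT : b < T) (n : ℕ) :
    ∀ f : ℝ → ℝ, ContDiffOn ℝ ((⊤ : ℕ∞) : WithTop ℕ∞) f (Ioo 0 T) → EqOn f 0 (Ioc 0 a) →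
      ∃ C, 0 ≤ C ∧ ∀ t ∈ Icc a b, |f t| ≤ C * (t - a) ^ n := by
  have hsub : Icc a b ⊆ Ioo 0 T := fun t ht => ⟨ha.trans_le ht.1, ht.2.trans_lt hbT⟩
  induction n with
  | zero =>
    intro f hf _
    obtain ⟨C, hC⟩ := isCompact_Icc.exists_bound_of_continuousOn (hf.continuousOn.mono hsub)
    exact ⟨C, (norm_nonneg _).trans (hC a (left_mem_Icc.2 hab.le)), fun t ht => by
      simpa using hC t ht⟩
  | succ n ih =>
    intro f hf h0
    have hf' := (contDiffOn_infty_iff_deriv_of_isOpen isOpen_Ioo).1 hf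
    have haT : a < T := hab.trans hbT
    have h1 : EqOn (deriv f) 0 (Ioo 0 a) := fun t ht => by
      have : f =ᶠ[𝓝 t] fun _ => 0 := by
        filter_upwards [Ioo_mem_nhds ht.1 ht.2] with s hs using h0 (Ioo_subset_Ioc_self hs)
      simp [this.deriv_eq]
    have h2 : EqOn (deriv f) 0 (Ioc 0 a) :=
      h1.of_subset_closure (hf'.2.continuousOn.mono fun t ht => ⟨ht.1, ht.2.trans_lt haT⟩)
        continuousOn_const Ioo_subset_Ioc_self
        (by rw [closure_Ioo ha.ne]; exact Ioc_subset_Icc_self)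
    obtain ⟨C, hC0, hC⟩ := ih (deriv f) hf'.2 h2
    refine ⟨C, hC0, fun t ht => ?_⟩
    have := (convex_Icc a t).norm_image_sub_le_of_norm_deriv_le (f := f) (C := C * (t - a) ^ n)
      (fun s hs => (hf'.1 s (hsub ⟨hs.1, hs.2.trans ht.2⟩)).differentiableAt
        (isOpen_Ioo.mem_nhds (hsub ⟨hs.1, hs.2.trans ht.2⟩)))
      (fun s hs => ?_) (left_mem_Icc.2 ht.1) (right_mem_Icc.2 ht.1)
    · rw [h0 ⟨ha, le_rfl⟩, Real.norm_eq_abs, Real.norm_of_nonneg (sub_nonneg.2 ht.1)] at this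
      simpa [pow_succ, mul_assoc] using this
    · refine (hC s ⟨hs.1, hs.2.trans ht.2⟩).trans ?_
      have := sub_nonneg.2 hs.1
      have := hs.2
      gcongr

/-- A solution starting from rest that is smooth for positive times has no dead core. -/
theorem IsOrbit.pos_of_smooth {α Λ T : ℝ} {u u' U V : ℝ → ℝ} (h : IsOrbit α Λ T u u')
    (hU : IsUniversalProfile α Λ U V) (hα : 0 ≤ α) (hΛ : 0 < Λ) (hT : 0 < T)
    (h0 : u 0 = 0) (h0' : u' 0 = 0) (huT : 0 < u T)
    (hs : ContDiffOn ℝ ((⊤ : ℕ∞) : WithTop ℕ∞) u (Ioo 0 T)) : ∀ t ∈ Ioc 0 T, 0 < u t := by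
  have hmono := h.monotoneOn hΛ h0'.ge
  have hcpt : IsCompact {t ∈ Icc 0 T | u t ∈ ({0} : Set ℝ)} :=
    isCompact_Icc.of_isClosed_subset
      (h.continuousOn.preimage_isClosed_of_isClosed isClosed_Icc isClosed_singleton)
      (sep_subset _ _)
  obtain ⟨a, ⟨haT, hua⟩, hmax⟩ := hcpt.exists_isGreatest ⟨0, left_mem_Icc.2 hT.le, h0⟩
  have hua : u a = 0 := hua
  have hpos : ∀ t ∈ Ioc a T, 0 < u t := by
    intro t ht
    have htT : t ∈ Icc 0 T := ⟨haT.1.trans ht.1.le, ht.2⟩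
    refine (h.nonneg t htT).lt_of_ne fun e => ?_
    have := hmax ⟨htT, e.symm⟩
    linarith [ht.1]
  rcases haT.1.eq_or_lt with ha | ha
  · rwa [← ha] at hpos
  exfalso
  have haT' : a < T := haT.2.lt_of_ne fun e => by rw [← e, hua] at huT; exact huT.false
  have hzero : EqOn u 0 (Icc 0 a) := fun t ht =>
    le_antisymm ((hmono ⟨ht.1, ht.2.trans haT.2⟩ haT ht.2).trans_eq hua)
      (h.nonneg t ⟨ht.1, ht.2.trans haT.2⟩)
  have hzero' : EqOn u' 0 (Ioo 0 a) := fun t ht =>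
    (h.hasDerivAt t ⟨ht.1, ht.2.trans haT'⟩).unique
      ((hasDerivAt_const t (0 : ℝ)).congr_of_eventuallyEq
        (by filter_upwards [Ioo_mem_nhds ht.1 ht.2] with s hs using hzero (Ioo_subset_Icc_self hs)))
  have hua' : u' a = 0 :=
    hzero'.of_subset_closure (h.mono haT.2).continuousOn_deriv continuousOn_const
      Ioo_subset_Icc_self (closure_Ioo ha.ne).ge (right_mem_Icc.2 ha.le)
  have hTa : 0 < T - a := sub_pos.2 haT'
  -- After its last zero `a`, the solution is a copy of `U` delayed by `a`.
  have heq := ((h.shift ha.le).eqOn_of_pos (hU.isOrbit (T - a)) hα hΛ hTa (by simpa) (by simpa)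
    (hU.eq_zero 0 le_rfl) (hU.deriv_eq_zero 0 le_rfl)
    (fun t ht => hpos _ ⟨by linarith [ht.1], by linarith [ht.2]⟩)
    (fun t ht => hU.pos ht.1)).1
  obtain ⟨k, hk, hlow⟩ := hU.lower (T - a) hTa
  obtain ⟨n, hn⟩ := exists_nat_ge (detachExp α + 1)
  obtain ⟨C, hC0, hC⟩ := exists_flat_bound (b := (a + T) / 2) ha (by linarith) (by linarith) n u hs
    (hzero.mono Ioc_subset_Icc_self)
  -- Flatness of order `n ≥ detachExp α + 1` against the lower power bound gives `k ≤ C * s`; the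
  -- last term of the minimum makes this false.
  set s := min (min 1 ((T - a) / 2)) (k / (2 * (C + 1))) with hsdef
  have hs0 : 0 < s := by positivity
  have hs1 : s ≤ 1 := (min_le_left _ _).trans (min_le_left _ _)
  have hs2 : s ≤ (T - a) / 2 := (min_le_left _ _).trans (min_le_right _ _)
  have hs3 : s ≤ k / (2 * (C + 1)) := min_le_right _ _
  have e1 : u (s + a) = U s := heq ⟨hs0.le, by linarith⟩
  have e2 := hlow s ⟨hs0, by linarith⟩
  have e3 := (le_abs_self _).trans (hC (s + a) ⟨by linarith, by linarith⟩)
  rw [e1, add_sub_cancel_right] at e3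
  have e4 : s ^ n ≤ s ^ detachExp α * s := by
    rw [← Real.rpow_natCast, ← Real.rpow_add_one hs0.ne']
    exact Real.rpow_le_rpow_of_exponent_ge hs0 hs1 hn
  have e5 : k * s ^ detachExp α ≤ (C * s) * s ^ detachExp α := by
    calc k * s ^ detachExp α ≤ C * s ^ n := e2.trans e3
      _ ≤ C * (s ^ detachExp α * s) := by gcongr
      _ = _ := by ring
  have e6 := le_of_mul_le_mul_right e5 (Real.rpow_pos_of_pos hs0 _)
  rw [le_div_iff₀ (by positivity)] at hs3
  nlinarith

/-! ### Rescaling between the free boundary problem and the profile. -/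

variable {α Λ c R lam : ℝ} {v U V : ℝ → ℝ}

theorem rpow_eq_mul_sq (hα1 : α < 1) (hc : 0 < c) :
    ∃ lam > 0, lam * c ^ 2 = lam ^ α := by
  refine ⟨(c ^ 2) ^ (1 / (α - 1)), by positivity, ?_⟩
  have h : α - 1 ≠ 0 := by linarith
  have hc2 : 0 < c ^ 2 := by positivity
  rw [← Real.rpow_mul hc2.le]
  nth_rewrite 2 [← Real.rpow_one (c ^ 2)]
  rw [← Real.rpow_add hc2]
  congr 1
  field_simp
  ring

namespace IsFreeBoundarySolution

theorem contDiffAt (h : IsFreeBoundarySolution α Λ c R v) {ξ : ℝ} (hξ : ξ ∈ Ioo 0 R) :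
    ContDiffAt ℝ ((⊤ : ℕ∞) : WithTop ℕ∞) v ξ :=
  h.smooth.contDiffAt (Ico_mem_nhds hξ.1 hξ.2)

theorem hasDerivAt (h : IsFreeBoundarySolution α Λ c R v) {ξ : ℝ} (hξ : ξ ∈ Ioo 0 R) :
    HasDerivAt v (derivWithin v (Icc 0 R) ξ) ξ := by
  rw [derivWithin_of_mem_nhds (Icc_mem_nhds hξ.1 hξ.2)]
  exact ((h.contDiffAt hξ).differentiableAt (by simp)).hasDerivAt

theorem hasDerivAt_derivWithin (h : IsFreeBoundarySolution α Λ c R v) {ξ : ℝ}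
    (hξ : ξ ∈ Ioo 0 R) :
    HasDerivAt (derivWithin v (Icc 0 R)) (deriv (deriv v) ξ) ξ := by
  have h1 : ContDiffOn ℝ ((⊤ : ℕ∞) : WithTop ℕ∞) (deriv v) (Ioo 0 R) :=
    ((contDiffOn_infty_iff_deriv_of_isOpen isOpen_Ioo).1 (h.smooth.mono Ioo_subset_Ico_self)).2
  have h2 : HasDerivAt (deriv v) (deriv (deriv v) ξ) ξ :=
    ((h1.contDiffAt (isOpen_Ioo.mem_nhds hξ)).differentiableAt (by simp)).hasDerivAt
  refine h2.congr_of_eventuallyEq ?_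
  filter_upwards [isOpen_Ioo.mem_nhds hξ] with s hs
  exact derivWithin_of_mem_nhds (Icc_mem_nhds hs.1 hs.2)

/-- Reversing space and rescaling turns a solution of the free boundary problem into a solution of
the normalised equation that starts from rest. -/
theorem isOrbit (h : IsFreeBoundarySolution α Λ c R v) (hΛ : 0 < Λ) (hlam : 0 < lam)
    (hrel : lam * c ^ 2 = lam ^ α) :
    IsOrbit α Λ (c * R) (fun t => v (R - t / c) / lam)
      (fun t => -derivWithin v (Icc 0 R) (R - t / c) / (lam * c)) := by
  have hc := h.speed_pos
  have hR := h.boundary_pos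
  have m1 : MapsTo (fun t => R - t / c) (Icc 0 (c * R)) (Icc 0 R) := fun t ht => by
    have h1 : 0 ≤ t / c := div_nonneg ht.1 hc.le
    have h2 : t / c ≤ R := (div_le_iff₀' hc).2 ht.2
    exact ⟨by linarith, by linarith⟩
  have m2 : MapsTo (fun t => R - t / c) (Ioo 0 (c * R)) (Ioo 0 R) := fun t ht => by
    have h1 : 0 < t / c := div_pos ht.1 hc
    have h2 : t / c < R := (div_lt_iff₀' hc).2 ht.2
    exact ⟨by linarith, by linarith⟩
  have hin : ∀ t, HasDerivAt (fun t => R - t / c) (-(1 / c)) t := fun t => by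
    simpa using ((hasDerivAt_id t).div_const c).const_sub R
  have hD := h.contDiffOn_one.continuousOn_derivWithin (uniqueDiffOn_Icc hR) le_rfl
  refine ⟨(h.contDiffOn_one.continuousOn.comp (by fun_prop) m1).div_const _,
    ((hD.comp (by fun_prop) m1).neg).div_const _, fun t ht => ?_, fun t ht => ?_, fun t ht => ?_⟩
  · have := ((h.hasDerivAt (m2 ht)).comp t (hin t)).div_const lam
    refine this.congr_deriv ?_
    field_simp
  · have := (((h.hasDerivAt_derivWithin (m2 ht)).comp t (hin t)).neg).div_const (lam * c)
    refine this.congr_deriv ?_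
    have hode := h.ode _ (m2 ht)
    rw [Real.div_rpow (h.nonneg _ (m1 (Ioo_subset_Icc_self ht))) hlam.le, ← hode, ← hrel,
      derivWithin_of_mem_nhds (Icc_mem_nhds (m2 ht).1 (m2 ht).2)]
    field_simp
    ring
  · exact div_nonneg (h.nonneg _ (m1 ht)) hlam.le

/-- Every solution of the free boundary problem is a rescaling of the universal profile. -/
theorem eq_rescaled (h : IsFreeBoundarySolution α Λ c R v) (hU : IsUniversalProfile α Λ U V)
    (hα : 0 ≤ α) (hΛ : 0 < Λ) (hlam : 0 < lam) (hrel : lam * c ^ 2 = lam ^ α) :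
    ∀ ξ ∈ Icc 0 R, v ξ = lam * U (c * R - c * ξ) ∧
      derivWithin v (Icc 0 R) ξ = -(lam * c * V (c * R - c * ξ)) := by
  have hc := h.speed_pos
  have hR := h.boundary_pos
  have hT : 0 < c * R := mul_pos hc hR
  have ho := h.isOrbit hΛ hlam hrel
  have e0 : R - c * R / c = 0 := by field_simp; ring
  have hmaps : MapsTo (fun t => R - t / c) (Ioo 0 (c * R)) (Ico 0 R) := fun t ht => by
    have h1 : 0 < t / c := div_pos ht.1 hc
    have h2 : t / c < R := (div_lt_iff₀' hc).2 ht.2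
    exact ⟨by linarith, by linarith⟩
  have hu0 : v (R - 0 / c) / lam = 0 := by simp [h.eq_zero]
  have hu0' : -derivWithin v (Icc 0 R) (R - 0 / c) / (lam * c) = 0 := by simp [h.deriv_eq_zero]
  have hpos := ho.pos_of_smooth hU hα hΛ hT hu0 hu0'
    (by rw [e0]; exact div_pos h.init_pos hlam)
    ((h.smooth.comp (by fun_prop) hmaps).div_const lam)
  obtain ⟨h1, h2⟩ := ho.eqOn_of_pos (hU.isOrbit (c * R)) hα hΛ hT hu0 hu0'
    (hU.eq_zero 0 le_rfl) (hU.deriv_eq_zero 0 le_rfl) hpos fun t ht => hU.pos ht.1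
  intro ξ hξ
  have ht : c * R - c * ξ ∈ Icc 0 (c * R) :=
    ⟨by nlinarith [hξ.2], by nlinarith [hξ.1]⟩
  have e : R - (c * R - c * ξ) / c = ξ := by field_simp; ring
  have h1 := h1 ht
  have h2 := h2 ht
  simp only [e] at h1 h2
  rw [← h1, ← h2]
  constructor <;> field_simp

end IsFreeBoundarySolution

/-- The amplitude with which the universal profile is to be multiplied when the travel time
is `T`. -/
noncomputable def amplitude (Λ : ℝ) (U V : ℝ → ℝ) (T : ℝ) : ℝ := 1 / (Λ * V T + U T)

/-- The speed cancels from the condition at `ξ = 0`, leaving `lam * (Λ V T + U T) = 1`. -/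
theorem IsFreeBoundarySolution.amplitude_eq (h : IsFreeBoundarySolution α Λ c R v)
    (hU : IsUniversalProfile α Λ U V) (hα : 0 ≤ α) (hΛ : 0 < Λ) (hlam : 0 < lam)
    (hrel : lam * c ^ 2 = lam ^ α) : lam = amplitude Λ U V (c * R) := by
  have hc := h.speed_pos
  obtain ⟨h1, h2⟩ := h.eq_rescaled hU hα hΛ hlam hrel 0 (left_mem_Icc.2 h.boundary_pos.le)
  have h3 := h.deriv_init
  rw [h2, h1] at h3
  simp only [mul_zero, sub_zero] at h3
  have hd := hU.denom_pos hΛ (mul_pos hc h.boundary_pos)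
  rw [amplitude, eq_div_iff hd.ne']
  field_simp at h3
  linarith

theorem amplitude_pos (hU : IsUniversalProfile α Λ U V) (hΛ : 0 < Λ) {T : ℝ} (hT : 0 < T) :
    0 < amplitude Λ U V T :=
  one_div_pos.2 (hU.denom_pos hΛ hT)

theorem IsFreeBoundarySolution.speed_sq (h : IsFreeBoundarySolution α Λ c R v)
    (hU : IsUniversalProfile α Λ U V) (hα0 : 0 ≤ α) (hα1 : α < 1) (hΛ : 0 < Λ) :
    amplitude Λ U V (c * R) * c ^ 2 = amplitude Λ U V (c * R) ^ α := by
  obtain ⟨lam, hlam, hrel⟩ := rpow_eq_mul_sq hα1 h.speed_pos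
  rwa [h.amplitude_eq hU hα0 hΛ hlam hrel] at hrel

/-- The travel time `c R` determines the solution. -/
theorem IsFreeBoundarySolution.eq_profile (h : IsFreeBoundarySolution α Λ c R v)
    (hU : IsUniversalProfile α Λ U V) (hα0 : 0 ≤ α) (hα1 : α < 1) (hΛ : 0 < Λ) :
    ∀ ξ ∈ Icc 0 R, v ξ = amplitude Λ U V (c * R) * U (c * R - c * ξ) ∧
      derivWithin v (Icc 0 R) ξ = -(amplitude Λ U V (c * R) * c * V (c * R - c * ξ)) :=
  h.eq_rescaled hU hα0 hΛ (amplitude_pos hU hΛ (mul_pos h.speed_pos h.boundary_pos))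
    (h.speed_sq hU hα0 hα1 hΛ)

theorem IsFreeBoundarySolution.init_eq (h : IsFreeBoundarySolution α Λ c R v)
    (hU : IsUniversalProfile α Λ U V) (hα0 : 0 ≤ α) (hα1 : α < 1) (hΛ : 0 < Λ) :
    U (c * R) / (Λ * V (c * R) + U (c * R)) = v 0 := by
  rw [(h.eq_profile hU hα0 hα1 hΛ 0 (left_mem_Icc.2 h.boundary_pos.le)).1, amplitude]
  simp only [mul_zero, sub_zero]
  ring

/-- The rescaled universal profile solves the free boundary problem. -/
theorem IsUniversalProfile.isFreeBoundarySolution (hU : IsUniversalProfile α Λ U V)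
    (hΛ : 0 < Λ) {T : ℝ} (hT : 0 < T) (hc : 0 < c)
    (hrel : amplitude Λ U V T * c ^ 2 = amplitude Λ U V T ^ α) :
    IsFreeBoundarySolution α Λ c (T / c) fun ξ => amplitude Λ U V T * U (T - c * ξ) := by
  set lam := amplitude Λ U V T with hlamdef
  have hlam : 0 < lam := amplitude_pos hU hΛ hT
  have hR : 0 < T / c := div_pos hT hc
  have hUT := hU.pos hT
  have hVT := hU.deriv_pos hΛ hT
  have hd := hU.denom_pos hΛ hT
  have hnorm : lam * (Λ * V T + U T) = 1 := by
    rw [hlamdef, amplitude]; field_simp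
  have hin : ∀ ξ, HasDerivAt (fun ξ => T - c * ξ) (-c) ξ := fun ξ => by
    simpa using ((hasDerivAt_id ξ).const_mul c).const_sub T
  have hv1 : ∀ ξ, HasDerivAt (fun ξ => lam * U (T - c * ξ)) (-(lam * c) * V (T - c * ξ)) ξ :=
    fun ξ => (((hU.hasDerivAt _).comp ξ (hin ξ)).const_mul lam).congr_deriv (by ring)
  have hdv : deriv (fun ξ => lam * U (T - c * ξ)) = fun ξ => -(lam * c) * V (T - c * ξ) :=
    funext fun ξ => (hv1 ξ).deriv
  have hv2 : ∀ ξ, HasDerivAt (fun ξ => -(lam * c) * V (T - c * ξ))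
      (lam * c ^ 2 * ((U (T - c * ξ) ^ α - V (T - c * ξ)) / Λ)) ξ :=
    fun ξ => (((hU.hasDerivAt_deriv _).comp ξ (hin ξ)).const_mul _).congr_deriv (by ring)
  have hdw : ∀ ξ ∈ Icc 0 (T / c), derivWithin (fun ξ => lam * U (T - c * ξ)) (Icc 0 (T / c)) ξ =
      -(lam * c) * V (T - c * ξ) := fun ξ hξ =>
    (hv1 ξ).hasDerivWithinAt.derivWithin (uniqueDiffOn_Icc hR ξ hξ)
  have eT : T - c * (T / c) = 0 := by field_simp; ring
  refine
    { speed_pos := hc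
      boundary_pos := hR
      smooth := ?_
      contDiffOn_one := ?_
      nonneg := fun ξ _ => mul_nonneg hlam.le (hU.nonneg _)
      ode := fun ξ hξ => ?_
      init_pos := ?_
      init_lt_one := ?_
      deriv_init := ?_
      eq_zero := ?_
      deriv_eq_zero := ?_ }
  · refine ContDiffOn.mul contDiffOn_const (hU.contDiffOn.comp (by fun_prop) fun ξ hξ => ?_)
    have := (lt_div_iff₀' hc).1 hξ.2
    exact sub_pos.2 this
  · exact (contDiff_const.mul (hU.contDiff_one.comp (by fun_prop))).contDiffOn
  · rw [hdv, (hv2 ξ).deriv, Real.mul_rpow hlam.le (hU.nonneg _), ← hrel]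
    field_simp
    ring
  · simpa using mul_pos hlam hUT
  · simp only [mul_zero, sub_zero]
    have : 0 < lam * (Λ * V T) := by positivity
    linarith
  · rw [hdw 0 (left_mem_Icc.2 hR.le)]
    simp only [mul_zero, sub_zero]
    field_simp
    linarith
  · simp only [eT, hU.eq_zero 0 le_rfl, mul_zero]
  · rw [hdw _ (right_mem_Icc.2 hR.le), eT, hU.deriv_eq_zero 0 le_rfl, mul_zero]

/-- Each datum fixes the next: `v₀` fixes `T` by the monotone ratio, `T` fixes the amplitude, `lam *
c ^ 2 = lam ^ α` fixes `c > 0`, and `R = T / c`. -/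
theorem scalarWellPosed (hα0 : 0 < α) (hα1 : α < 1) (hΛ : 0 < Λ) {v₀ : ℝ} (h0 : 0 < v₀)
    (h1 : v₀ < 1) : ScalarWellPosed α Λ v₀ := by
  obtain ⟨U, V, hU⟩ := exists_isUniversalProfile hα0 hα1 hΛ
  obtain ⟨T, hT, hTv⟩ := hU.exists_ratio_eq hΛ h0 h1
  have hlam : 0 < amplitude Λ U V T := amplitude_pos hU hΛ hT
  set c := amplitude Λ U V T ^ ((α - 1) / 2) with hcdef
  have hc : 0 < c := Real.rpow_pos_of_pos hlam _
  have hrel : amplitude Λ U V T * c ^ 2 = amplitude Λ U V T ^ α := by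
    rw [hcdef, ← Real.rpow_natCast, ← Real.rpow_mul hlam.le]
    nth_rewrite 1 [← Real.rpow_one (amplitude Λ U V T)]
    rw [← Real.rpow_add hlam]
    congr 1
    push_cast
    ring
  refine ⟨c, T / c, _, ⟨hU.isFreeBoundarySolution hΛ hT hc hrel, ?_⟩, ?_⟩
  · simp only [mul_zero, sub_zero, ← hTv, amplitude]
    ring
  · intro c' R' v' h
    have hc' := h.speed_pos
    have hT' : c' * R' = T := by
      refine (hU.strictMonoOn_ratio hα0 hα1 hΛ).injOn (mem_Ioi.2 (mul_pos hc' h.boundary_pos)) hT ?_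
      rw [h.toIsFreeBoundarySolution.init_eq hU hα0.le hα1 hΛ, h.init, hTv]
    have hsq := h.toIsFreeBoundarySolution.speed_sq hU hα0.le hα1 hΛ
    rw [hT', ← hrel] at hsq
    have hcc : c' = c := (pow_left_inj₀ hc'.le hc.le two_ne_zero).1 (mul_left_cancel₀ hlam.ne' hsq)
    have hRR : R' = T / c := by rw [← hT', ← hcc]; field_simp
    refine ⟨hcc, hRR, fun ξ hξ => ?_⟩
    rw [← hRR] at hξ
    rw [(h.toIsFreeBoundarySolution.eq_profile hU hα0.le hα1 hΛ ξ hξ).1, hT', hcc]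

theorem isScalarSolution (hα0 : 0 < α) (hα1 : α < 1) (hΛ : 0 < Λ) {v₀ : ℝ} (h0 : 0 < v₀)
    (h1 : v₀ < 1) :
    IsScalarSolution α Λ v₀ (speed α Λ v₀) (boundary α Λ v₀) (profile α Λ v₀) := by
  obtain ⟨c, R, v, h, -⟩ := scalarWellPosed hα0 hα1 hΛ h0 h1
  exact Classical.epsilon_spec
    (p := fun p : ℝ × ℝ × (ℝ → ℝ) => IsScalarSolution α Λ v₀ p.1 p.2.1 p.2.2) ⟨(c, R, v), h⟩

/-! ### The map `Phi` in terms of the travel time. -/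

theorem IsFreeBoundarySolution.integral_exp_mul (h : IsFreeBoundarySolution α Λ c R v)
    (hU : IsUniversalProfile α Λ U V) (hα0 : 0 ≤ α) (hα1 : α < 1) (hΛ : 0 < Λ) :
    ∫ s in (0 : ℝ)..R, Real.exp (-c * s) * (-derivWithin v (Icc 0 R) s) =
      amplitude Λ U V (c * R) *
        (Real.exp (-(c * R)) * ∫ t in (0 : ℝ)..(c * R), Real.exp t * V t) := by
  have hc := h.speed_pos
  have h1 : ∀ s ∈ uIcc 0 R, Real.exp (-c * s) * (-derivWithin v (Icc 0 R) s) =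
      (fun t => amplitude Λ U V (c * R) * c * Real.exp (-(c * R)) * (Real.exp t * V t))
        (c * R - c * s) := by
    intro s hs
    rw [uIcc_of_le h.boundary_pos.le] at hs
    rw [(h.eq_profile hU hα0 hα1 hΛ s hs).2,
      show -c * s = -(c * R) + (c * R - c * s) by ring, Real.exp_add]
    ring
  rw [intervalIntegral.integral_congr h1, intervalIntegral.integral_comp_sub_mul
    (fun t => amplitude Λ U V (c * R) * c * Real.exp (-(c * R)) * (Real.exp t * V t)) hc.ne',
    intervalIntegral.integral_const_mul]
  simp only [sub_self, mul_zero, sub_zero, smul_eq_mul]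
  field_simp

theorem IsUniversalProfile.monotoneOn_deriv (hU : IsUniversalProfile α Λ U V) (hα : 0 < α)
    (hΛ : 0 < Λ) : MonotoneOn V (Ici 0) := by
  refine monotoneOn_of_hasDerivWithinAt_nonneg (convex_Ici 0) hU.continuous_deriv.continuousOn
    (fun t _ => (hU.hasDerivAt_deriv t).hasDerivWithinAt) (fun t ht => ?_)
  rw [interior_Ici] at ht
  exact (hU.deriv_deriv_pos hα hΛ ht).le

theorem IsUniversalProfile.integral_exp_mul_pos (hU : IsUniversalProfile α Λ U V) (hΛ : 0 < Λ)
    {T : ℝ} (hT : 0 < T) : 0 < Real.exp (-T) * ∫ t in (0 : ℝ)..T, Real.exp t * V t := by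
  have hV := hU.continuous_deriv
  refine mul_pos (Real.exp_pos _) (intervalIntegral.intervalIntegral_pos_of_pos_on
    (Continuous.intervalIntegrable (by fun_prop) _ _)
    (fun t ht => mul_pos (Real.exp_pos _) (hU.deriv_pos hΛ ht.1)) hT)

/-- As `V` increases, the left side is at most `(1 - exp (-T)) * V T`. -/
theorem IsUniversalProfile.integral_exp_mul_lt (hU : IsUniversalProfile α Λ U V) (hα : 0 < α)
    (hΛ : 0 < Λ) {T : ℝ} (hT : 0 < T) :
    Real.exp (-T) * ∫ t in (0 : ℝ)..T, Real.exp t * V t < V T := by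
  have hV := hU.continuous_deriv
  have hVT := hU.deriv_pos hΛ hT
  have h1 : ∫ t in (0 : ℝ)..T, Real.exp t * V t ≤ ∫ t in (0 : ℝ)..T, Real.exp t * V T :=
    intervalIntegral.integral_mono_on hT.le (Continuous.intervalIntegrable (by fun_prop) _ _)
      (Continuous.intervalIntegrable (by fun_prop) _ _) fun t ht =>
        mul_le_mul_of_nonneg_left (hU.monotoneOn_deriv hα hΛ ht.1 hT.le ht.2) (Real.exp_pos _).le
  rw [intervalIntegral.integral_mul_const, integral_exp, Real.exp_zero] at h1
  calc Real.exp (-T) * ∫ t in (0 : ℝ)..T, Real.exp t * V t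
      ≤ Real.exp (-T) * ((Real.exp T - 1) * V T) := by gcongr
    _ = V T - Real.exp (-T) * V T := by
        have : Real.exp (-T) * Real.exp T = 1 := by rw [← Real.exp_add]; simp
        linear_combination V T * this
    _ < V T := sub_lt_self _ (by positivity)

/-- The quantity `prePhi` in terms of the travel time. -/
noncomputable def travelPhi (θ Λ : ℝ) (U V : ℝ → ℝ) (T : ℝ) : ℝ :=
  1 - θ + (1 - Λ) *
    (amplitude Λ U V T * (Real.exp (-T) * ∫ t in (0 : ℝ)..T, Real.exp t * V t))

theorem continuousOn_travelPhi (hU : IsUniversalProfile α Λ U V) (hΛ : 0 < Λ) (θ : ℝ) :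
    ContinuousOn (travelPhi θ Λ U V) (Ioi 0) := by
  have hUc := hU.continuous
  have hVc := hU.continuous_deriv
  have h1 : Continuous fun T => ∫ t in (0 : ℝ)..T, Real.exp t * V t :=
    intervalIntegral.continuous_primitive
      (fun a b => Continuous.intervalIntegrable (by fun_prop) a b) 0
  have h2 : ContinuousOn (amplitude Λ U V) (Ioi 0) :=
    ContinuousOn.div continuousOn_const (by fun_prop) fun t ht => (hU.denom_pos hΛ ht).ne'
  unfold travelPhi
  fun_prop

theorem prePhi_eq (hU : IsUniversalProfile α Λ U V) (hα0 : 0 < α) (hα1 : α < 1) (hΛ : 0 < Λ)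
    (θ : ℝ) {v₀ : ℝ} (h0 : 0 < v₀) (h1 : v₀ < 1) :
    ∃ T > 0, U T / (Λ * V T + U T) = v₀ ∧ prePhi α θ Λ v₀ = travelPhi θ Λ U V T := by
  have h := isScalarSolution hα0 hα1 hΛ h0 h1
  have h' := h.toIsFreeBoundarySolution
  refine ⟨_, mul_pos h.speed_pos h.boundary_pos, ?_, ?_⟩
  · rw [h'.init_eq hU hα0.le hα1 hΛ, h.init]
  · rw [travelPhi, ← h'.integral_exp_mul hU hα0.le hα1 hΛ]
    rfl

/-- This moves the fixed-point equation to the variable `T`, so continuity of `prePhi` in `v₀` is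
not needed. -/
theorem prePhi_ratio (hU : IsUniversalProfile α Λ U V) (hα0 : 0 < α) (hα1 : α < 1) (hΛ : 0 < Λ)
    (θ : ℝ) {T : ℝ} (hT : 0 < T) :
    prePhi α θ Λ (U T / (Λ * V T + U T)) = travelPhi θ Λ U V T := by
  have hd := hU.denom_pos hΛ hT
  obtain ⟨S, hS, hST, hpre⟩ := prePhi_eq hU hα0 hα1 hΛ θ (div_pos (hU.pos hT) hd)
    ((div_lt_one hd).2 (by linarith [mul_pos hΛ (hU.deriv_pos hΛ hT)]))
  rw [hpre, (hU.strictMonoOn_ratio hα0 hα1 hΛ).injOn hS hT hST]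

theorem exists_isFixedPt_Phi (hα0 : 0 < α) (hα1 : α < 1) {θ : ℝ} (hθ0 : 0 < θ) (hθ1 : θ < 1)
    (hΛ0 : 0 < Λ) (hI : 1 - θ ≤ 1 - Λ * θ) :
    ∃ v₀ : Icc (1 - θ) (1 - Λ * θ), Function.IsFixedPt (Phi α θ Λ hI) v₀ := by
  obtain ⟨U, V, hU⟩ := exists_isUniversalProfile hα0 hα1 hΛ0
  have hΛθ : 0 < Λ * θ := mul_pos hΛ0 hθ0
  obtain ⟨a, ha, hav⟩ := hU.exists_ratio_eq hΛ0 (y := 1 - θ) (by linarith) (by linarith)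
  obtain ⟨b, hb, hbv⟩ := hU.exists_ratio_eq hΛ0 (y := 1 - Λ * θ) (by linarith) (by linarith)
  have hab : a ≤ b := ((hU.strictMonoOn_ratio hα0 hα1 hΛ0).le_iff_le ha hb).1 (by
    rw [hav, hbv]; exact hI)
  have hsub : Icc a b ⊆ Ioi 0 := fun t ht => ha.trans_le ht.1
  have hcont : ContinuousOn (fun t => (projIcc (1 - θ) (1 - Λ * θ) hI (travelPhi θ Λ U V t) : ℝ) -
      U t / (Λ * V t + U t)) (Icc a b) := by
    refine ContinuousOn.sub ?_ ((hU.continuousOn_ratio hΛ0).mono hsub)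
    exact (continuous_subtype_val.comp continuous_projIcc).comp_continuousOn
      ((continuousOn_travelPhi hU hΛ0 θ).mono hsub)
  -- The projected value lies between the two endpoint ratios, so the difference is nonnegative at
  -- `a` and nonpositive at `b`.
  obtain ⟨t, ht, hzero⟩ := intermediate_value_Icc' hab hcont (show (0 : ℝ) ∈ Icc _ _ from
    ⟨by rw [hbv, sub_nonpos]; exact (projIcc _ _ hI _).2.2,
     by rw [hav, sub_nonneg]; exact (projIcc _ _ hI _).2.1⟩)
  refine ⟨projIcc _ _ hI (travelPhi θ Λ U V t), ?_⟩
  rw [Function.IsFixedPt, Phi, sub_eq_zero.1 hzero,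
    prePhi_ratio hU hα0 hα1 hΛ0 θ (hsub ht)]

/-- The projection is not active at a fixed point. -/
theorem prePhi_mem_Ioo (hα0 : 0 < α) (hα1 : α < 1) {θ : ℝ} (hθ0 : 0 < θ) (hθ1 : θ < 1)
    (hΛ0 : 0 < Λ) (hΛ1 : Λ < 1) (hI : 1 - θ ≤ 1 - Λ * θ) {v₀ : Icc (1 - θ) (1 - Λ * θ)}
    (hfix : Function.IsFixedPt (Phi α θ Λ hI) v₀) :
    prePhi α θ Λ v₀ ∈ Ioo (1 - θ) (1 - Λ * θ) := by
  obtain ⟨U, V, hU⟩ := exists_isUniversalProfile hα0 hα1 hΛ0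
  have hΛθ : 0 < Λ * θ := mul_pos hΛ0 hθ0
  have hv := v₀.2
  obtain ⟨T, hT, hTv, hpre⟩ := prePhi_eq hU hα0 hα1 hΛ0 θ (v₀ := v₀) (by linarith [hv.1])
    (by linarith [hv.2])
  have hlam := amplitude_pos hU hΛ0 hT
  have hpos := mul_pos hlam (hU.integral_exp_mul_pos hΛ0 hT)
  have hlt := mul_lt_mul_of_pos_left (hU.integral_exp_mul_lt hα0 hΛ0 hT) hlam
  have h1Λ : 0 < 1 - Λ := by linarith
  refine ⟨?_, ?_⟩
  · rw [hpre, travelPhi]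
    linarith [mul_pos h1Λ hpos]
  · by_contra! hge
    have hv0 : (v₀ : ℝ) = 1 - Λ * θ := by
      rw [← hfix, Phi, projIcc_of_right_le hI hge]
    have hd := hU.denom_pos hΛ0 hT
    -- Here `Λ * amplitude * V T = 1 - v₀ = Λ * θ`; the integral is then below `θ`, and `1 - θ + (1
    -- - Λ) * θ = 1 - Λ * θ`.
    have hθ : amplitude Λ U V T * V T = θ := by
      rw [hv0, div_eq_iff hd.ne'] at hTv
      rw [amplitude, one_div_mul_eq_div, div_eq_iff hd.ne']
      refine mul_left_cancel₀ hΛ0.ne' ?_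
      linarith
    rw [hθ] at hlt
    rw [hpre, travelPhi] at hge
    linarith [mul_lt_mul_of_pos_left hlt h1Λ]

end FlameFront

theorem theorem7p1 (α θ Λ : ℝ) (hα0 : 0 < α) (hα1 : α < 1) (hθ0 : 0 < θ) (hθ1 : θ < 1)
    (hΛ0 : 0 < Λ) (hΛ1 : Λ < 1) :
    (∀ v₀ ∈ Set.Icc (1 - θ) (1 - Λ * θ), FlameFront.ScalarWellPosed α Λ v₀) ∧
    (∃ v₀ : Set.Icc (1 - θ) (1 - Λ * θ),
      Function.IsFixedPt (FlameFront.Phi α θ Λ (FlameFront.endpoint_le hθ0 hΛ1)) v₀) ∧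
    (∀ v₀ : Set.Icc (1 - θ) (1 - Λ * θ),
      Function.IsFixedPt (FlameFront.Phi α θ Λ (FlameFront.endpoint_le hθ0 hΛ1)) v₀ →
        FlameFront.IsFreeBoundarySolution α Λ (FlameFront.speed α Λ v₀)
          (FlameFront.boundary α Λ v₀) (FlameFront.profile α Λ v₀) ∧
        FlameFront.profile α Λ v₀ 0 = v₀ ∧
        θ + FlameFront.profile α Λ v₀ 0 =
          1 - (1 - Λ) * ∫ s in (0 : ℝ)..(FlameFront.boundary α Λ v₀),
            Real.exp (-(FlameFront.speed α Λ v₀) * s) * FlameFront.profileDeriv α Λ v₀ s ∧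
        FlameFront.prePhi α θ Λ v₀ ∈ Set.Ioo (1 - θ) (1 - Λ * θ)) := by
  have hΛθ : 0 < Λ * θ := mul_pos hΛ0 hθ0
  refine ⟨fun v₀ hv => FlameFront.scalarWellPosed hα0 hα1 hΛ0 (by linarith [hv.1])
      (by linarith [hv.2]),
    FlameFront.exists_isFixedPt_Phi hα0 hα1 hθ0 hθ1 hΛ0 _, fun v₀ hfix => ?_⟩
  have h := FlameFront.isScalarSolution hα0 hα1 hΛ0 (v₀ := v₀) (by linarith [v₀.2.1])
    (by linarith [v₀.2.2])
  have hmem := FlameFront.prePhi_mem_Ioo hα0 hα1 hθ0 hθ1 hΛ0 hΛ1 _ hfix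
  refine ⟨h.toIsFreeBoundarySolution, h.init, ?_, hmem⟩
  -- With the projection inactive, the fixed-point equation is the integral equation itself.
  have hval : (v₀ : ℝ) = FlameFront.prePhi α θ Λ v₀ := by
    conv_lhs => rw [← hfix, FlameFront.Phi, projIcc_of_mem _ (Ioo_subset_Icc_self hmem)]
  rw [h.init]
  conv_lhs => rw [hval, FlameFront.prePhi]
  simp only [mul_neg, intervalIntegral.integral_neg]
  ring
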